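/- All graphs are finite and simple, and a polynomial $p:\mathbb{N}\to\mathbb{N}$ is a function that agrees on $\mathbb{N}=\{0,1,2,\dots\}$ with a real polynomial. For an integer $\ell\ge 0$, a depth-$\ell$ minor of a graph $G$ is a graph obtained from a subgraph of $G$ by contracting pairwise vertex-disjoint connected subgraphs, each of radius at most $\ell$; $\nabla_\ell(G)$ is the maximum of $|E(H)|/|V(H)|$ over all depth-$\ell$ minors $H$ of $G$ (a graph without vertices has density $0$). The expansion of $G$ is bounded by $p$ if $\nabla_\ell(G)\le p(\ell)$ for every integer $\ell\ge 0$. A balanced separator in $G$ is a set $C\subseteq V(G)$ such that each component of $G-C$ has at most $\tfrac23|V(G)|$ vertices. For $\rho:V(G)\to[0,\infty)$ and $X\subseteq V(G)$ let $\rho(X)=\sum_{x\in X}\rho(x)$. For an integer $t\ge 1$ and a real $s\ge 0$, a set $C\subseteq V(G)$ is $(\rho/t)$-cheap with $s$ outliers if there is a set $C'\subseteq C$ with $|C'|\le s$ and $\rho(C\setminus C')\le\rho(V(G))/t$. Let $\log^{(0)}x=x$ and $\log^{(i+1)}x=\log_2\max(2,\log^{(i)}x)$ for $i\ge 0$. Theorem.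 For every polynomial $p:\mathbb{N}\to\mathbb{N}$ and every integer $a\ge 0$, there exists a polynomial $q:\mathbb{N}\to\mathbb{N}$ such that the following holds. Let $G$ be an $n$-vertex graph with expansion bounded by $p$ and let $\rho:V(G)\to[0,\infty)$. Then for every integer $t\ge 1$, $G$ has a balanced separator that is $(\rho/t)$-cheap with $\exp(q(t))\cdot\log^{(a)}n$ outliers. -/

import Mathlib

open scoped NNReal

/-- A function `ℕ → ℕ` that is a polynomial, i.e. the restriction to `ℕ` of some real polynomial. -/
def IsPolynomialFun (p : ℕ → ℕ) : Prop :=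
  ∃ P : Polynomial ℝ, ∀ n : ℕ, (p n : ℝ) = P.eval (n : ℝ)

/-- The iterated logarithm: `log^(0) x = x`, `log^(i+1) x = log₂ max(2, log^(i) x)`. -/
noncomputable def iterLog : ℕ → ℝ → ℝ
  | 0, x => x
  | i + 1, x => Real.logb 2 (max 2 (iterLog i x))

namespace SimpleGraph

/-- `H` is a depth-`ℓ` minor of `G`: it is obtained from a subgraph of `G` by contracting pairwise
vertex-disjoint connected subgraphs of radius at most `ℓ`. The subgraph `bag w` is the one that is
contracted to the vertex `w` of `H` (a single vertex, of radius `0`, if nothing is contracted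
there); the vertices and edges of `G` that are not used are those deleted on passing to the
subgraph. -/
def IsDepthMinor {W V : Type*} (ℓ : ℕ) (H : SimpleGraph W) (G : SimpleGraph V) : Prop :=
  ∃ bag : W → G.Subgraph,
    (∀ w, (bag w).Connected ∧ (bag w).coe.radius ≤ (ℓ : ℕ∞)) ∧
    (∀ w₁ w₂, w₁ ≠ w₂ → Disjoint (bag w₁).verts (bag w₂).verts) ∧
    (∀ w₁ w₂, H.Adj w₁ w₂ → ∃ x ∈ (bag w₁).verts, ∃ y ∈ (bag w₂).verts, G.Adj x y)

/-- The density `|E(H)| / |V(H)|` of a graph (`0` for the graph without vertices). -/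
noncomputable def edgeVertexDensity {W : Type*} (H : SimpleGraph W) : ℝ :=
  (H.edgeSet.ncard : ℝ) / (Nat.card W : ℝ)

/-- The densities of the depth-`ℓ` minors of `G` (up to isomorphism, a finite minor has vertex set
`Fin k`). -/
def depthMinorDensities {V : Type*} (ℓ : ℕ) (G : SimpleGraph V) : Set ℝ :=
  {d | ∃ (k : ℕ) (H : SimpleGraph (Fin k)), H.IsDepthMinor ℓ G ∧ H.edgeVertexDensity = d}

/-- `∇_ℓ(G)`, the maximum density of a depth-`ℓ` minor of the finite graph `G`. -/
noncomputable def nabla {V : Type*} (ℓ : ℕ) (G : SimpleGraph V) : ℝ :=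
  sSup (depthMinorDensities ℓ G)

/-- For a finite graph the supremum in the definition of `∇_ℓ(G)` is a maximum. -/
theorem nabla_isGreatest {V : Type*} [Finite V] (ℓ : ℕ) (G : SimpleGraph V) :
    IsGreatest (depthMinorDensities ℓ G) (nabla ℓ G) := by
  have hfin : (depthMinorDensities ℓ G).Finite := by
    have hf : (⋃ k ∈ Set.Iic (Nat.card V),
        Set.range (fun H : SimpleGraph (Fin k) => H.edgeVertexDensity)).Finite :=
      (Set.finite_Iic _).biUnion fun k _ => Set.finite_range _
    refine hf.subset ?_
    rintro d ⟨k, H, ⟨bag, hb, hdisj, -⟩, rfl⟩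
    have hne : ∀ w, (bag w).verts.Nonempty := fun w => (hb w).1.nonempty
    choose f hf' using hne
    have hinj : Function.Injective f := by
      intro a b hab
      by_contra h
      exact Set.disjoint_left.1 (hdisj a b h) (hf' a) (hab ▸ hf' b)
    have hk : k ≤ Nat.card V := by
      simpa using Nat.card_le_card_of_injective f hinj
    exact Set.mem_biUnion (Set.mem_Iic.2 hk) ⟨H, rfl⟩
  have hnon : (depthMinorDensities ℓ G).Nonempty :=
    ⟨_, 0, ⊥, ⟨fun w => w.elim0, fun w => w.elim0, fun w => w.elim0, fun w => w.elim0⟩, rfl⟩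
  exact ⟨hnon.csSup_mem hfin, fun _ hd => le_csSup hfin.bddAbove hd⟩

/-- The expansion of `G` is bounded by `f`. -/
def ExpansionBoundedBy {V : Type*} (G : SimpleGraph V) (f : ℕ → ℕ) : Prop :=
  ∀ ℓ : ℕ, nabla ℓ G ≤ (f ℓ : ℝ)

/-- `C` is a balanced separator in `G`: each component of `G - C` has at most `2/3 |V(G)|`
vertices. -/
def IsBalancedSeparator {V : Type*} (G : SimpleGraph V) (C : Finset V) : Prop :=
  ∀ K : (G.induce ((C : Set V)ᶜ)).ConnectedComponent,
    (K.supp.ncard : ℝ) ≤ 2 / 3 * (Nat.card V : ℝ)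

end SimpleGraph

/-- `C` is `(ρ/t)`-cheap with `q` outliers: for some `C' ⊆ C` with `|C'| ≤ q`, we have
`ρ(C \ C') ≤ ρ(V) / t`. The bound `q` may be any real number. -/
def CheapWithOutliers {V : Type*} [Fintype V] [DecidableEq V] (ρ : V → ℝ≥0) (t : ℕ) (q : ℝ)
    (C : Finset V) : Prop :=
  ∃ C' ⊆ C, (C'.card : ℝ) ≤ q ∧ ∑ v ∈ C \ C', ρ v ≤ (∑ v, ρ v) / (t : ℝ≥0)

/-!
The proof works with separators relative to a set `S` of terminals: `C` halves `S` if every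
connected subgraph of `G - C` has at most half of `S`. For `S = V(G)` this is stronger than being a
balanced separator.

A shallow-minor argument in the style of Plotkin, Rao and Smith (`exists_halves_of_state`) finds a
set that halves `S` and is `(ρ/t)`-cheap with a number of outliers that is polynomial in `t` and
`log |S|`; the number of vertices of `G` plays no role. A region `R` with more than half of `S` is
cut down step by step, next to a model of a clique minor each of whose bags contains a terminal.
Take a terminal `s` in `R`. If all bags are close to `s` in `R`, short walks from `s` form a new
bag. The bounded expansion limits the number of bags, so these are the outliers. If some bag is far
from `s`, then the ball in `R` around `s` or the one around the neighbourhood of the bag misses half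
of `S`, and it is cut off at a cheap layer. A layer counts as cheap if its weight is at most a
`1/t` fraction of the weight of the ball inside it plus `ρ(V)/(t |S|)`. The second term is
affordable because each cut disposes of a terminal, either `s` or the one in the discarded bag, and with it
`O(t log |S|)` layers are enough to find a cheap one (`exists_slow_step`).

The set `T` of outliers obtained in this way is small, so separating `T` itself needs far fewer
outliers. Only the part of `G` with more than half of `S` matters, so halving the vertices of `T` in
that part `log |T|` times makes `T` superfluous (`exists_halves_of_outliers`). One round replaces
`log |S|` by `log log |S|` in the bound, up to polynomial factors in `t`, and induction gives a
bound polynomial in `t` and the iterated logarithm of any order (`exists_halves_iterLog`). The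
iterated logarithm of order `a + 1` is used to obtain the bound with `exp (q t)` for order `a`.
-/

namespace SimpleGraph

/-! ### Linked sets and halving separators -/

/-- `K` is linked if it induces a connected (or empty) subgraph of `G`. Connectedness is encoded by
cuts: a set that meets `K` and is closed under adjacency inside `K` contains `K`. -/
def IsLinked {V : Type*} (G : SimpleGraph V) (K : Finset V) : Prop :=
  ∀ R : Set V, (∃ v ∈ K, v ∈ R) → (∀ u ∈ K, u ∈ R → ∀ v ∈ K, G.Adj u v → v ∈ R) →
    ∀ v ∈ K, v ∈ R

/-- `C` halves the terminal set `S`: every connected subgraph of `G - C` has at most half of the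
vertices of `S`. -/
def Halves {V : Type*} [DecidableEq V] (G : SimpleGraph V) (C S : Finset V) : Prop :=
  ∀ K : Finset V, G.IsLinked K → Disjoint K C → 2 * (K ∩ S).card ≤ S.card

theorem not_disjoint_of_large {V : Type*} [DecidableEq V] {K K' S : Finset V}
    (hK : S.card < 2 * (K ∩ S).card) (hK' : S.card < 2 * (K' ∩ S).card) :
    ¬ Disjoint K K' := by
  intro h
  have h1 : Disjoint (K ∩ S) (K' ∩ S) :=
    h.mono Finset.inter_subset_left Finset.inter_subset_left
  have h2 : ((K ∩ S) ∪ (K' ∩ S)).card ≤ S.card :=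
    Finset.card_le_card (Finset.union_subset Finset.inter_subset_right Finset.inter_subset_right)
  rw [Finset.card_union_of_disjoint h1] at h2
  omega

theorem isLinked_biUnion {V : Type*} [DecidableEq V] {G : SimpleGraph V}
    {F : Finset (Finset V)} (hF : ∀ K ∈ F, G.IsLinked K)
    (hFF : ∀ K ∈ F, ∀ K' ∈ F, ¬ Disjoint K K') : G.IsLinked (F.biUnion id) := by
  rintro R ⟨v, hv, hvR⟩ hR w hw
  simp only [Finset.mem_biUnion, id] at hv hw hR
  obtain ⟨K, hK, hvK⟩ := hv
  obtain ⟨K', hK', hwK'⟩ := hw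
  obtain ⟨x, hx, hx'⟩ := Finset.not_disjoint_iff.1 (hFF K hK K' hK')
  have hxR := hF K hK R ⟨v, hvK, hvR⟩
    (fun u hu huR v hv huv => hR u ⟨K, hK, hu⟩ huR v ⟨K, hK, hv⟩ huv) x hx
  exact hF K' hK' R ⟨x, hx', hxR⟩
    (fun u hu huR v hv huv => hR u ⟨K', hK', hu⟩ huR v ⟨K', hK', hv⟩ huv) w hwK'

/-- A region `R` whose outside neighbours lie in `C` absorbs every linked set that avoids `C` and
meets `R`. -/
theorem IsLinked.subset_of_boundary {V : Type*} {G : SimpleGraph V}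
    {K R C : Finset V} (hK : G.IsLinked K) (hKC : Disjoint K C) (hKR : ¬ Disjoint K R)
    (hR : ∀ u ∈ R, ∀ v, G.Adj u v → v ∈ R ∨ v ∈ C) : K ⊆ R := by
  obtain ⟨x, hx, hx'⟩ := Finset.not_disjoint_iff.1 hKR
  intro v hv
  refine hK (R : Set V) ⟨x, hx, hx'⟩ (fun u _ huR v hv huv => ?_) v hv
  exact (hR u huR v huv).resolve_right (Finset.disjoint_left.1 hKC hv)

theorem Halves.isBalancedSeparator {V : Type*} [Fintype V] [DecidableEq V] {G : SimpleGraph V}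
    {C : Finset V} (h : G.Halves C Finset.univ) : G.IsBalancedSeparator C := by
  classical
  intro K
  have hfin : (Subtype.val '' K.supp).Finite := Set.toFinite _
  set L : Finset V := hfin.toFinset with hL
  have hmem : ∀ v, v ∈ L ↔ ∃ h : v ∈ (C : Set V)ᶜ, (⟨v, h⟩ : ((C : Set V)ᶜ : Set V)) ∈ K.supp := by
    intro v; simp [hL]
  have hlink : G.IsLinked L := by
    rintro R ⟨v, hv, hvR⟩ hR w hw
    obtain ⟨hvC, hvK⟩ := (hmem v).1 hv
    obtain ⟨hwC, hwK⟩ := (hmem w).1 hw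
    have hreach : (G.induce ((C : Set V)ᶜ)).Reachable ⟨v, hvC⟩ ⟨w, hwC⟩ := by
      rw [ConnectedComponent.mem_supp_iff] at hvK hwK
      exact ConnectedComponent.exact (hvK.trans hwK.symm)
    obtain ⟨p⟩ := hreach
    have key : ∀ (x y : ((C : Set V)ᶜ : Set V)) (_ : (G.induce ((C : Set V)ᶜ)).Walk x y),
        x ∈ K.supp → (x : V) ∈ R → (y : V) ∈ R := by
      intro x y p
      induction p with
      | nil => exact fun _ h => h
      | @cons x z y hxz p ih =>
        intro hx hxR
        have hz : z ∈ K.supp := by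
          rw [ConnectedComponent.mem_supp_iff] at hx ⊢
          rw [← hx]
          exact (ConnectedComponent.sound hxz.reachable).symm
        exact ih hz (hR x ((hmem x).2 ⟨x.2, hx⟩) hxR z ((hmem z).2 ⟨z.2, hz⟩) hxz)
    exact key _ _ p hvK hvR
  have hdisj : Disjoint L C := by
    rw [Finset.disjoint_left]
    intro v hv hvC
    obtain ⟨h1, -⟩ := (hmem v).1 hv
    exact h1 hvC
  have h2 := h L hlink hdisj
  have h3 : K.supp.ncard = L.card := by
    rw [← Set.ncard_image_of_injective K.supp Subtype.val_injective,
      Set.ncard_eq_toFinset_card _ hfin]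
  rw [h3, Nat.card_eq_fintype_card]
  rw [Finset.inter_univ, Finset.card_univ] at h2
  have h4 : (2 : ℝ) * L.card ≤ Fintype.card V := by exact_mod_cast h2
  have h5 : (0 : ℝ) ≤ Fintype.card V := Nat.cast_nonneg _
  linarith

/-! ### Balls inside a region -/

open scoped Classical in
/-- The vertices reachable from `U` by at most `j` steps inside the region `R`
(for `U ⊆ R`). -/
noncomputable def regionBall {V : Type*} (G : SimpleGraph V) (R U : Finset V) : ℕ → Finset V
  | 0 => U
  | j + 1 => R.filter fun v => v ∈ regionBall G R U j ∨ ∃ u ∈ regionBall G R U j, G.Adj u v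

section regionBall

variable {V : Type*} {G : SimpleGraph V} {R U : Finset V}

theorem mem_regionBall_succ {j : ℕ} {v : V} :
    v ∈ G.regionBall R U (j + 1) ↔
      v ∈ R ∧ (v ∈ G.regionBall R U j ∨ ∃ u ∈ G.regionBall R U j, G.Adj u v) := by
  simp [regionBall]

theorem regionBall_subset (hU : U ⊆ R) (j : ℕ) : G.regionBall R U j ⊆ R := by
  cases j with
  | zero => exact hU
  | succ j => exact fun v hv => (mem_regionBall_succ.1 hv).1

theorem regionBall_mono (hU : U ⊆ R) : Monotone (G.regionBall R U) :=
  monotone_nat_of_le_succ fun j _ hv =>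
    mem_regionBall_succ.2 ⟨regionBall_subset hU j hv, Or.inl hv⟩

theorem exists_mem_regionBall_add {X Y : Finset V} (hX : X ⊆ R) (hY : Y ⊆ R) {j : ℕ} :
    ∀ {i : ℕ} {v : V}, v ∈ G.regionBall R X i → v ∈ G.regionBall R Y j →
      ∃ y ∈ Y, y ∈ G.regionBall R X (i + j) := by
  induction j with
  | zero => exact fun {i v} hv hv' => ⟨v, hv', hv⟩
  | succ j ih =>
    intro i v hv hv'
    obtain ⟨-, h | ⟨u, hu, huv⟩⟩ := mem_regionBall_succ.1 hv'
    · obtain ⟨y, hy, hy'⟩ := ih hv h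
      exact ⟨y, hy, regionBall_mono hX (by omega) hy'⟩
    · obtain ⟨y, hy, hy'⟩ := ih (i := i + 1)
        (mem_regionBall_succ.2 ⟨regionBall_subset hY j hu, Or.inr ⟨v, hv, huv.symm⟩⟩) hu
      exact ⟨y, hy, by rwa [show i + (j + 1) = i + 1 + j by omega]⟩

theorem exists_walk_of_mem_regionBall {s : V} (hs : s ∈ R) {j : ℕ} :
    ∀ {v : V}, v ∈ G.regionBall R {s} j →
      ∃ p : G.Walk s v, p.length ≤ j ∧ ∀ w ∈ p.support, w ∈ R := by
  induction j with
  | zero =>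
    intro v hv
    obtain rfl : v = s := by simpa [regionBall] using hv
    exact ⟨Walk.nil, le_rfl, by simpa using hs⟩
  | succ j ih =>
    intro v hv
    obtain ⟨hvR, h | ⟨u, hu, huv⟩⟩ := mem_regionBall_succ.1 hv
    · obtain ⟨p, hp, hp'⟩ := ih h
      exact ⟨p, by omega, hp'⟩
    · obtain ⟨p, hp, hp'⟩ := ih hu
      refine ⟨p.concat huv, by simpa using hp, fun w hw => ?_⟩
      rw [Walk.support_concat, List.mem_append, List.mem_singleton] at hw
      rcases hw with hw | rfl
      · exact hp' w hw
      · exact hvR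

end regionBall

end SimpleGraph

/-- A bounded sequence cannot grow quickly at each of its first `t * L` steps. The reason is that
`b j + W / m` would grow by more than a factor `1 + 1 / t` at each step, hence by more than a factor
`2` in `t` steps, from at least `W / m` to more than `(m + 1) * (W / m) = W + W / m`. -/
theorem exists_slow_step {b : ℕ → ℝ} {W : ℝ} {t m L : ℕ} (hb0 : 0 ≤ b 0) (hbW : ∀ j, b j ≤ W)
    (ht : 1 ≤ t) (hm : 1 ≤ m) (hL : m < 2 ^ L) :
    ∃ j < t * L, b (j + 1) - b j ≤ b j / t + W / (t * m) := by
  by_contra! hcon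
  have ht' : (0 : ℝ) < t := by exact_mod_cast ht
  have hm' : (0 : ℝ) < m := by exact_mod_cast hm
  have hW : 0 ≤ W := hb0.trans (hbW 0)
  have hstep : ∀ j < t * L, (1 + 1 / (t : ℝ)) ^ j * (W / m) ≤ b j + W / m →
      (1 + 1 / (t : ℝ)) ^ (j + 1) * (W / m) < b (j + 1) + W / m := by
    intro j hj h1
    have h2 := hcon j hj
    have h3 : (b j + W / m) * (1 + 1 / (t : ℝ)) = b j + W / m + (b j / t + W / (t * m)) := by
      field_simp
    calc (1 + 1 / (t : ℝ)) ^ (j + 1) * (W / m)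
        = ((1 + 1 / (t : ℝ)) ^ j * (W / m)) * (1 + 1 / (t : ℝ)) := by ring
      _ ≤ (b j + W / m) * (1 + 1 / (t : ℝ)) := by gcongr
      _ < b (j + 1) + W / m := by rw [h3]; linarith
  have hgrow : ∀ j ≤ t * L, (1 + 1 / (t : ℝ)) ^ j * (W / m) ≤ b j + W / m := by
    intro j
    induction j with
    | zero => intro _; simpa using hb0
    | succ j ih => exact fun hj => (hstep j hj (ih (by omega))).le
  have hLpos : 0 < L := by
    rcases Nat.eq_zero_or_pos L with rfl | h
    · simp at hL; omega
    · exact h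
  have htL : 0 < t * L := Nat.mul_pos ht hLpos
  have h2t : (2 : ℝ) ≤ (1 + 1 / (t : ℝ)) ^ t := by
    have := one_add_mul_le_pow (a := 1 / (t : ℝ))
      (by have : 0 ≤ 1 / (t : ℝ) := by positivity
          linarith) t
    have h : (t : ℝ) * (1 / t) = 1 := by field_simp
    linarith
  have hpow : (m : ℝ) + 1 ≤ (1 + 1 / (t : ℝ)) ^ (t * L) := by
    rw [pow_mul]
    have : (m : ℝ) + 1 ≤ 2 ^ L := by exact_mod_cast hL
    exact this.trans (pow_le_pow_left₀ (by norm_num) h2t L)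
  have hend : ((m : ℝ) + 1) * (W / m) = W + W / m := by field_simp
  have h1 := hstep (t * L - 1) (by omega) (hgrow _ (by omega))
  rw [Nat.sub_add_cancel htL] at h1
  have h2 : ((m : ℝ) + 1) * (W / m) ≤ (1 + 1 / (t : ℝ)) ^ (t * L) * (W / m) :=
    mul_le_mul_of_nonneg_right hpow (by positivity)
  have h3 := hbW (t * L)
  linarith

namespace SimpleGraph

/-! ### Bags of a shallow clique minor -/

/-- A bag of radius at most `d` with its centre in `S`: every vertex of `M` is reached from the
centre by a walk of length at most `d` that stays inside `M`. -/
def IsBag {V : Type*} (G : SimpleGraph V) (d : ℕ) (S M : Finset V) : Prop :=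
  ∃ s ∈ M, s ∈ S ∧ ∀ v ∈ M, ∃ p : G.Walk s v, p.length ≤ d ∧ ∀ w ∈ p.support, w ∈ M

/-- A family of disjoint, pairwise adjacent bags, that is, a model of a clique as a
depth-`d` minor. -/
structure IsCliqueModel {V : Type*} (G : SimpleGraph V) (d : ℕ) (S : Finset V)
    (F : Finset (Finset V)) : Prop where
  isBag : ∀ M ∈ F, G.IsBag d S M
  disjoint : ∀ M ∈ F, ∀ N ∈ F, M ≠ N → Disjoint M N
  adj : ∀ M ∈ F, ∀ N ∈ F, M ≠ N → ∃ x ∈ M, ∃ y ∈ N, G.Adj x y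

theorem IsCliqueModel.mono {V : Type*} {G : SimpleGraph V} {d : ℕ} {S : Finset V}
    {F F' : Finset (Finset V)} (h : G.IsCliqueModel d S F) (hF : F' ⊆ F) :
    G.IsCliqueModel d S F' where
  isBag M hM := h.isBag M (hF hM)
  disjoint M hM N hN := h.disjoint M (hF hM) N (hF hN)
  adj M hM N hN := h.adj M (hF hM) N (hF hN)

theorem exists_walk_coe_induce {V : Type*} {G : SimpleGraph V} {M : Set V} {s v : V}
    (p : G.Walk s v) (hp : ∀ w ∈ p.support, w ∈ M) (hs : s ∈ M) (hv : v ∈ M) :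
    ∃ q : ((⊤ : G.Subgraph).induce M).coe.Walk ⟨s, hs⟩ ⟨v, hv⟩, q.length = p.length := by
  induction p with
  | nil => exact ⟨Walk.nil, rfl⟩
  | @cons a b c hab p ih =>
    have hb : b ∈ M := hp b (by simp)
    obtain ⟨q, hq⟩ := ih (fun w hw => hp w (by simp [hw])) hb hv
    have hadj : ((⊤ : G.Subgraph).induce M).coe.Adj ⟨a, hs⟩ ⟨b, hb⟩ := by
      simpa [Subgraph.induce_adj] using ⟨hs, hb, hab⟩
    exact ⟨Walk.cons hadj q, by simp [hq]⟩

theorem IsBag.connected_and_radius_le {V : Type*} {G : SimpleGraph V} {d : ℕ} {S M : Finset V}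
    (h : G.IsBag d S M) : ((⊤ : G.Subgraph).induce (M : Set V)).Connected ∧
      ((⊤ : G.Subgraph).induce (M : Set V)).coe.radius ≤ (d : ℕ∞) := by
  obtain ⟨s, hs, -, hM⟩ := h
  have hwalk : ∀ v : ((⊤ : G.Subgraph).induce (M : Set V)).verts,
      ∃ q : ((⊤ : G.Subgraph).induce (M : Set V)).coe.Walk ⟨s, hs⟩ v, q.length ≤ d := by
    rintro ⟨v, hv⟩
    obtain ⟨p, hp, hp'⟩ := hM v hv
    obtain ⟨q, hq⟩ := exists_walk_coe_induce p (M := (M : Set V)) hp' hs hv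
    exact ⟨q, hq.trans_le hp⟩
  refine ⟨⟨?_⟩, ?_⟩
  · rw [connected_iff_exists_forall_reachable]
    exact ⟨⟨s, hs⟩, fun v => (hwalk v).elim fun q _ => q.reachable⟩
  · refine (iInf_le _ (⟨s, hs⟩ : ((⊤ : G.Subgraph).induce (M : Set V)).verts)).trans
      (iSup_le fun v => ?_)
    obtain ⟨q, hq⟩ := hwalk v
    exact q.edist_le.trans (by exact_mod_cast hq)

theorem edgeVertexDensity_top (k : ℕ) :
    (⊤ : SimpleGraph (Fin k)).edgeVertexDensity = ((k : ℝ) - 1) / 2 ∨ k = 0 := by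
  rcases Nat.eq_zero_or_pos k with rfl | hk
  · exact Or.inr rfl
  left
  have hk' : (k : ℝ) ≠ 0 := by exact_mod_cast hk.ne'
  have h1 : (⊤ : SimpleGraph (Fin k)).edgeSet.ncard = k.choose 2 := by
    rw [← coe_edgeFinset, Set.ncard_coe_finset, card_edgeFinset_top_eq_card_choose_two,
      Fintype.card_fin]
  rw [edgeVertexDensity, h1, Nat.card_eq_fintype_card, Fintype.card_fin, Nat.cast_choose_two]
  field_simp

/-- The clique on the bags has density `(|F| - 1) / 2`, which the expansion bounds. -/
theorem IsCliqueModel.card_le {V : Type*} [Finite V] {G : SimpleGraph V} {p : ℕ → ℕ}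
    (hG : G.ExpansionBoundedBy p) {d : ℕ} {S : Finset V} {F : Finset (Finset V)}
    (h : G.IsCliqueModel d S F) : F.card ≤ 2 * p d + 1 := by
  have e := F.equivFin.symm
  have hminor : (⊤ : SimpleGraph (Fin F.card)).IsDepthMinor d G := by
    refine ⟨fun i => (⊤ : G.Subgraph).induce ((e i : Finset V) : Set V),
      fun i => (h.isBag _ (e i).2).connected_and_radius_le, fun i j hij => ?_, fun i j hij => ?_⟩
    · exact Finset.disjoint_coe.2 (h.disjoint _ (e i).2 _ (e j).2
        fun hc => hij (e.injective (Subtype.ext hc)))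
    · exact h.adj _ (e i).2 _ (e j).2 fun hc => hij.ne (e.injective (Subtype.ext hc))
  rcases edgeVertexDensity_top F.card with hd | h0
  · have h1 : ((F.card : ℝ) - 1) / 2 ≤ p d :=
      ((nabla_isGreatest d G).2 ⟨_, _, hminor, hd⟩).trans (hG d)
    have h2 : (F.card : ℝ) ≤ 2 * p d + 1 := by linarith
    exact_mod_cast h2
  · omega

/-- Short walks inside `R` from one centre `s` to each of the sets `N(M)`, `M ∈ F`, form together
a bag of `R` that is adjacent to every member of `F`. -/
theorem exists_bag_of_reach {V : Type*} [DecidableEq V] {G : SimpleGraph V} {d : ℕ}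
    {S R : Finset V} {F : Finset (Finset V)} {s : V} (hsR : s ∈ R) (hsS : s ∈ S)
    (hreach : ∀ M ∈ F, ∃ y ∈ G.regionBall R {s} d, ∃ x ∈ M, G.Adj x y) :
    ∃ N ⊆ R, s ∈ N ∧ G.IsBag d S N ∧ N.card ≤ F.card * (d + 1) + 1 ∧
      ∀ M ∈ F, ∃ x ∈ M, ∃ y ∈ N, G.Adj x y := by
  have : Nonempty V := ⟨s⟩
  choose! y hy x hx hxy using hreach
  have hw : ∀ M ∈ F, ∃ P : Finset V, y M ∈ P ∧ P ⊆ R ∧ P.card ≤ d + 1 ∧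
      ∀ v ∈ P, ∃ q : G.Walk s v, q.length ≤ d ∧ ∀ w ∈ q.support, w ∈ P := by
    intro M hM
    obtain ⟨p, hp, hp'⟩ := exists_walk_of_mem_regionBall hsR (hy M hM)
    refine ⟨p.support.toFinset, by simp, fun v hv => hp' v (by simpa using hv), ?_, ?_⟩
    · refine (List.toFinset_card_le _).trans ?_
      rw [Walk.length_support]
      omega
    · intro v hv
      have hv' : v ∈ p.support := by simpa using hv
      refine ⟨p.takeUntil v hv', (p.length_takeUntil_le_length hv').trans hp, fun w hw => ?_⟩
      simpa using p.support_takeUntil_subset_support hv' hw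
  choose! P hyP hPR hPcard hPwalk using hw
  refine ⟨insert s (F.biUnion P), ?_, Finset.mem_insert_self _ _,
    ⟨s, Finset.mem_insert_self _ _, hsS, ?_⟩, ?_, ?_⟩
  · exact Finset.insert_subset hsR (Finset.biUnion_subset.2 hPR)
  · intro v hv
    rcases Finset.mem_insert.1 hv with rfl | hv
    · exact ⟨Walk.nil, by simp, by simp⟩
    · obtain ⟨M, hM, hvM⟩ := Finset.mem_biUnion.1 hv
      obtain ⟨q, hq, hq'⟩ := hPwalk M hM v hvM
      exact ⟨q, hq, fun w hw =>
        Finset.mem_insert_of_mem (Finset.mem_biUnion.2 ⟨M, hM, hq' w hw⟩)⟩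
  · refine (Finset.card_insert_le _ _).trans (Nat.add_le_add_right ?_ 1)
    exact Finset.card_biUnion_le_card_mul _ _ _ hPcard
  · exact fun M hM => ⟨x M, hx M hM, y M,
      Finset.mem_insert_of_mem (Finset.mem_biUnion.2 ⟨M, hM, hyP M hM⟩), hxy M hM⟩

/-- If the ball of radius `t * size |S|` around `U` in the region `R` has at most half of the
terminals, then one of its layers `X` is cheap compared to the smaller ball `A` that it encloses.
Either `C ∪ X` halves `S`, or the rest of `R` is again a region with more than half of the
terminals. -/
theorem exists_cheap_layer {V : Type*} [Fintype V] [DecidableEq V] {G : SimpleGraph V}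
    {ρ : V → ℝ} (hρ : ∀ v, 0 ≤ ρ v) {t : ℕ} (ht : 1 ≤ t) {S R U C : Finset V} (hS : S.Nonempty)
    (hU : U ⊆ R) (hsmall : 2 * (G.regionBall R U (t * Nat.size S.card) ∩ S).card ≤ S.card)
    (hbd : ∀ u ∈ R, ∀ v, G.Adj u v → v ∈ R ∨ v ∈ C)
    (hR : S.card < 2 * (R ∩ S).card) :
    ∃ X A : Finset V, U ⊆ A ∧ A ⊆ R ∧ X ⊆ R \ A ∧
      ∑ v ∈ X, ρ v ≤ (∑ v ∈ A, ρ v) / t + (∑ v, ρ v) / (t * S.card) ∧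
      (∀ u ∈ R \ (A ∪ X), ∀ v, G.Adj u v → v ∈ R \ (A ∪ X) ∨ v ∈ C ∪ X) ∧
      (G.Halves (C ∪ X) S ∨ S.card < 2 * ((R \ (A ∪ X)) ∩ S).card) := by
  have hmono := regionBall_mono (G := G) hU
  obtain ⟨j, hj, hslow⟩ := exists_slow_step
    (b := fun j => ∑ v ∈ G.regionBall R U j, ρ v) (W := ∑ v, ρ v)
    (Finset.sum_nonneg fun v _ => hρ v)
    (fun j => Finset.sum_le_sum_of_subset_of_nonneg (Finset.subset_univ _) fun v _ _ => hρ v)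
    ht hS.card_pos (Nat.lt_size_self S.card)
  set A := G.regionBall R U j with hA
  set A' := G.regionBall R U (j + 1) with hA'
  have hAA' : A ⊆ A' := hmono (Nat.le_succ j)
  have hunion : A ∪ (A' \ A) = A' := Finset.union_sdiff_of_subset hAA'
  have hA'R : A' ⊆ R := regionBall_subset hU _
  have hbdry : ∀ u ∈ R \ A', ∀ v, G.Adj u v → v ∈ R \ A' ∨ v ∈ C ∪ (A' \ A) := by
    intro u hu v huv
    rw [Finset.mem_sdiff] at hu
    rcases hbd u hu.1 v huv with hv | hv
    · by_cases hvA' : v ∈ A'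
      · have hvA : v ∉ A := fun hvA =>
          hu.2 (mem_regionBall_succ.2 ⟨hu.1, Or.inr ⟨v, hvA, huv.symm⟩⟩)
        exact Or.inr (Finset.mem_union_right _ (Finset.mem_sdiff.2 ⟨hvA', hvA⟩))
      · exact Or.inl (Finset.mem_sdiff.2 ⟨hv, hvA'⟩)
    · exact Or.inr (Finset.mem_union_left _ hv)
  refine ⟨A' \ A, A, hmono (Nat.zero_le j), regionBall_subset hU j,
    Finset.sdiff_subset_sdiff hA'R le_rfl, ?_, ?_, ?_⟩
  · have := Finset.sum_sdiff (f := ρ) hAA'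
    linarith
  · rw [hunion]; exact hbdry
  · rw [hunion, or_iff_not_imp_left]
    intro hnot
    simp only [Halves, not_forall, not_le] at hnot
    obtain ⟨K, hK, hKC, hKbig⟩ := hnot
    have hKR : K ⊆ R := hK.subset_of_boundary (hKC.mono_right Finset.subset_union_left)
      (not_disjoint_of_large hKbig hR) hbd
    have hKA : ¬ K ⊆ A := by
      intro hc
      have h1 : (K ∩ S).card ≤ (G.regionBall R U (t * Nat.size S.card) ∩ S).card :=
        Finset.card_le_card (Finset.inter_subset_inter_right (hc.trans (hmono hj.le)))
      omega
    obtain ⟨v, hvK, hvA⟩ := Finset.not_subset.1 hKA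
    have hvA' : v ∉ A' := fun h => Finset.disjoint_left.1 hKC hvK
      (Finset.mem_union_right _ (Finset.mem_sdiff.2 ⟨h, hvA⟩))
    have hK' : K ⊆ R \ A' := hK.subset_of_boundary hKC
      (Finset.not_disjoint_iff.2 ⟨v, hvK, Finset.mem_sdiff.2 ⟨hKR hvK, hvA'⟩⟩) hbdry
    exact hKbig.trans_le
      (Nat.mul_le_mul_left 2 (Finset.card_le_card (Finset.inter_subset_inter_right hK')))

end SimpleGraph

namespace SimpleGraph

/-! ### Separators relative to a terminal set -/

/-- The main loop of the argument. A state consists of a region `R` with more than half of the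
terminals, a cheap set `B`, and a clique model `F`, such that `B` and the bags separate `R` from the
rest. The last hypothesis is the accounting: each cut is paid for by the vertices that
leave `R` and by one terminal that leaves both `R` and the bags. -/
theorem exists_halves_of_state {V : Type*} [Fintype V] [DecidableEq V] {G : SimpleGraph V}
    {p : ℕ → ℕ} (hG : G.ExpansionBoundedBy p) {ρ : V → ℝ} (hρ : ∀ v, 0 ≤ ρ v) {t : ℕ}
    (ht : 1 ≤ t) {S : Finset V} (hS : S.Nonempty) {d h : ℕ}
    (hd : d = t * Nat.size S.card + t * Nat.size S.card) (hh : h = 2 * p d + 1) (N : ℕ) :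
    ∀ (R B : Finset V) (F : Finset (Finset V)), 2 * R.card + F.card ≤ N →
      G.IsCliqueModel d S F → (∀ M ∈ F, M.card ≤ h * (d + 1) + 1) → (∀ M ∈ F, Disjoint R M) →
      (∀ u ∈ R, ∀ v, G.Adj u v → v ∈ R ∨ v ∈ B ∪ F.biUnion id) →
      S.card < 2 * (R ∩ S).card →
      ∑ v ∈ B, ρ v + (∑ v ∈ R, ρ v) / t
          + (S ∩ (R ∪ F.biUnion id)).card * ((∑ v, ρ v) / (t * S.card)) ≤ 2 * ((∑ v, ρ v) / t) →
      ∃ B O : Finset V, G.Halves (B ∪ O) S ∧ ∑ v ∈ B, ρ v ≤ 2 * ((∑ v, ρ v) / t) ∧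
        O.card ≤ h * (h * (d + 1) + 1) := by
  classical
  induction N with
  | zero =>
    intro R B F hN _ _ _ _ hR _
    have : R.card = 0 := by omega
    rw [Finset.card_eq_zero] at this
    simp [this] at hR
  | succ N ih =>
    intro R B F hN hF hFcard hFR hbd hR hcost
    set W := ∑ v, ρ v with hW
    set c := W / (t * S.card) with hc
    have hW0 : 0 ≤ W := Finset.sum_nonneg fun v _ => hρ v
    have hc0 : 0 ≤ c := by positivity
    have hsum : ∀ {X Y : Finset V}, X ⊆ Y → ∑ v ∈ X, ρ v ≤ ∑ v ∈ Y, ρ v := fun hXY =>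
      Finset.sum_le_sum_of_subset_of_nonneg hXY fun v _ _ => hρ v
    have hsum0 : ∀ X : Finset V, 0 ≤ ∑ v ∈ X, ρ v := fun X => Finset.sum_nonneg fun v _ => hρ v
    have ht0 : (0 : ℝ) < t := by exact_mod_cast ht
    have hOcard : ∀ F' : Finset (Finset V), G.IsCliqueModel d S F' →
        (∀ M ∈ F', M.card ≤ h * (d + 1) + 1) → (F'.biUnion id).card ≤ h * (h * (d + 1) + 1) := by
      intro F' hF' hF'card
      refine (Finset.card_biUnion_le_card_mul _ _ _ hF'card).trans ?_
      exact Nat.mul_le_mul_right _ (hh ▸ hF'.card_le hG)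
    -- Cutting off a small ball around `U`; the terminal `z` pays for the layer.
    have hcut : ∀ (U : Finset V) (F' : Finset (Finset V)), U ⊆ R → U.Nonempty → F' ⊆ F →
        2 * (G.regionBall R U (t * Nat.size S.card) ∩ S).card ≤ S.card →
        (∀ u ∈ R \ U, ∀ v ∈ F.biUnion id, G.Adj u v → v ∈ F'.biUnion id) →
        (∃ z ∈ S, z ∈ R ∪ F.biUnion id ∧ z ∉ (R \ U) ∪ F'.biUnion id) →
        ∃ B O : Finset V, G.Halves (B ∪ O) S ∧ ∑ v ∈ B, ρ v ≤ 2 * (W / t) ∧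
          O.card ≤ h * (h * (d + 1) + 1) := by
      rintro U F' hU hUne hF' hsmall hUF ⟨z, hzS, hz, hz'⟩
      obtain ⟨X, A, hUA, hAR, hX, hXcost, hbd', hor⟩ :=
        exists_cheap_layer hρ ht hS hU hsmall hbd hR
      have hBX : ∑ v ∈ B ∪ X, ρ v ≤ ∑ v ∈ B, ρ v + ((∑ v ∈ A, ρ v) / t + c) := by
        have h1 : ∑ v ∈ B ∪ X, ρ v ≤ ∑ v ∈ B, ρ v + ∑ v ∈ X, ρ v := by
          rw [← Finset.sum_union_inter]
          exact le_add_of_nonneg_right (hsum0 _)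
        linarith
      have hRsplit : (∑ v ∈ R \ (A ∪ X), ρ v) / t + (∑ v ∈ A, ρ v) / t
          ≤ (∑ v ∈ R, ρ v) / t := by
        rw [← add_div]
        have h1 : ∑ v ∈ R \ (A ∪ X), ρ v ≤ ∑ v ∈ R \ A, ρ v :=
          hsum (Finset.sdiff_subset_sdiff le_rfl Finset.subset_union_left)
        have h2 := Finset.sum_sdiff (f := ρ) hAR
        gcongr
        linarith
      have hcount : (S ∩ (R \ (A ∪ X) ∪ F'.biUnion id)).card + 1
          ≤ (S ∩ (R ∪ F.biUnion id)).card := by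
        refine Finset.card_lt_card (Finset.ssubset_iff_subset_ne.2 ⟨?_, fun heq => ?_⟩)
        · exact Finset.inter_subset_inter_left
            (Finset.union_subset_union Finset.sdiff_subset
              (Finset.biUnion_subset_biUnion_of_subset_left _ hF'))
        · have h1 : z ∈ S ∩ (R \ (A ∪ X) ∪ F'.biUnion id) := by
            rw [heq]; exact Finset.mem_inter.2 ⟨hzS, hz⟩
          refine hz' (Finset.union_subset_union ?_ le_rfl (Finset.mem_inter.1 h1).2)
          exact Finset.sdiff_subset_sdiff le_rfl (hUA.trans Finset.subset_union_left)
      have hcount' : ((S ∩ (R \ (A ∪ X) ∪ F'.biUnion id)).card : ℝ) * c + c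
          ≤ (S ∩ (R ∪ F.biUnion id)).card * c := by
        have h1 : ((S ∩ (R \ (A ∪ X) ∪ F'.biUnion id)).card : ℝ) + 1
            ≤ (S ∩ (R ∪ F.biUnion id)).card := by exact_mod_cast hcount
        have := mul_le_mul_of_nonneg_right h1 hc0
        linarith
      have hcost' : ∑ v ∈ B ∪ X, ρ v + (∑ v ∈ R \ (A ∪ X), ρ v) / t
          + (S ∩ (R \ (A ∪ X) ∪ F'.biUnion id)).card * c ≤ 2 * (W / t) := by linarith
      rcases hor with hor | hor
      · refine ⟨B ∪ X, F.biUnion id, by rwa [Finset.union_right_comm], ?_, hOcard F hF hFcard⟩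
        have h1 : 0 ≤ (∑ v ∈ R \ (A ∪ X), ρ v) / t := div_nonneg (hsum0 _) ht0.le
        have h2 : 0 ≤ ((S ∩ (R \ (A ∪ X) ∪ F'.biUnion id)).card : ℝ) * c := by positivity
        linarith
      · refine ih (R \ (A ∪ X)) (B ∪ X) F' ?_ (hF.mono hF') (fun M hM => hFcard M (hF' hM))
          (fun M hM => (hFR M (hF' hM)).mono_left Finset.sdiff_subset) ?_ hor hcost'
        · have h1 : (R \ (A ∪ X)).card < R.card := by
            obtain ⟨u, hu⟩ := hUne
            refine Finset.card_lt_card ⟨Finset.sdiff_subset, fun hc => ?_⟩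
            exact (Finset.mem_sdiff.1 (hc (hU hu))).2 (Finset.mem_union_left _ (hUA hu))
          have h2 := Finset.card_le_card hF'
          omega
        · intro u hu v huv
          have huU : u ∈ R \ U :=
            Finset.sdiff_subset_sdiff le_rfl (hUA.trans Finset.subset_union_left) hu
          rcases hbd' u hu v huv with hv | hv
          · exact Or.inl hv
          · right
            rcases Finset.mem_union.1 hv with hv | hv
            · rcases Finset.mem_union.1 hv with hv | hv
              · exact Finset.mem_union_left _ (Finset.mem_union_left _ hv)
              · exact Finset.mem_union_right _ (hUF u huU v hv huv)
            · exact Finset.mem_union_left _ (Finset.mem_union_right _ hv)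
    have herase : ∀ M ∈ F, ∀ u ∈ R, (∀ x ∈ M, ¬ G.Adj x u) → ∀ v ∈ F.biUnion id, G.Adj u v →
        v ∈ (F.erase M).biUnion id := by
      intro M hM u hu hMu v hv huv
      obtain ⟨M', hM', hvM'⟩ := Finset.mem_biUnion.1 hv
      refine Finset.mem_biUnion.2 ⟨M', Finset.mem_erase.2 ⟨?_, hM'⟩, hvM'⟩
      rintro rfl
      exact hMu v hvM' huv.symm
    obtain ⟨s, hs⟩ : (R ∩ S).Nonempty := by
      rw [← Finset.card_pos]; omega
    obtain ⟨hsR, hsS⟩ := Finset.mem_inter.1 hs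
    have hsR' : {s} ⊆ R := Finset.singleton_subset_iff.2 hsR
    by_cases hreach : ∀ M ∈ F, ∃ y ∈ G.regionBall R {s} d, ∃ x ∈ M, G.Adj x y
    · -- All bags are near `s`: a further bag is added.
      obtain ⟨P, hPR, hsP, hPbag, hPcard, hPadj⟩ := exists_bag_of_reach hsR hsS hreach
      have hPM : ∀ M ∈ F, Disjoint P M := fun M hM => (hFR M hM).mono_left hPR
      have hF' : G.IsCliqueModel d S (insert P F) := by
        refine ⟨?_, ?_, ?_⟩
        · intro M hM
          rcases Finset.mem_insert.1 hM with rfl | hM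
          · exact hPbag
          · exact hF.isBag M hM
        · intro M hM M' hM' hne
          rcases Finset.mem_insert.1 hM with rfl | hMF <;>
            rcases Finset.mem_insert.1 hM' with rfl | hMF'
          · exact absurd rfl hne
          · exact hPM M' hMF'
          · exact (hPM M hMF).symm
          · exact hF.disjoint M hMF M' hMF' hne
        · intro M hM M' hM' hne
          rcases Finset.mem_insert.1 hM with rfl | hMF <;>
            rcases Finset.mem_insert.1 hM' with rfl | hMF'
          · exact absurd rfl hne
          · obtain ⟨x, hx, y, hy, hxy⟩ := hPadj M' hMF'
            exact ⟨y, hy, x, hx, hxy.symm⟩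
          · exact hPadj M hMF
          · exact hF.adj M hMF M' hMF' hne
      have hF'card : ∀ M ∈ insert P F, M.card ≤ h * (d + 1) + 1 := by
        intro M hM
        rcases Finset.mem_insert.1 hM with rfl | hM
        · exact hPcard.trans (Nat.add_le_add_right
            (Nat.mul_le_mul_right _ (hh ▸ hF.card_le hG)) 1)
        · exact hFcard M hM
      have hbU : (insert P F).biUnion id = P ∪ F.biUnion id := by
        rw [Finset.biUnion_insert]; rfl
      by_cases hdone : G.Halves (B ∪ (insert P F).biUnion id) S
      · refine ⟨B, _, hdone, ?_, hOcard _ hF' hF'card⟩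
        have h1 : 0 ≤ (∑ v ∈ R, ρ v) / t := div_nonneg (hsum0 _) ht0.le
        have h2 : 0 ≤ ((S ∩ (R ∪ F.biUnion id)).card : ℝ) * c := by positivity
        linarith
      · simp only [Halves, not_forall, not_le] at hdone
        obtain ⟨K, hK, hKC, hKbig⟩ := hdone
        rw [hbU] at hKC
        have hKR : K ⊆ R := hK.subset_of_boundary
          (hKC.mono_right (Finset.union_subset_union le_rfl Finset.subset_union_right))
          (not_disjoint_of_large hKbig hR) hbd
        have hKP : Disjoint K P := hKC.mono_right
          (Finset.subset_union_left.trans Finset.subset_union_right)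
        refine ih (R \ P) B (insert P F) ?_ hF' hF'card ?_ ?_ ?_ ?_
        · have h1 : (R \ P).card < R.card :=
            Finset.card_lt_card ⟨Finset.sdiff_subset, fun hc => (Finset.mem_sdiff.1 (hc hsR)).2 hsP⟩
          have h2 := Finset.card_insert_le P F
          omega
        · intro M hM
          rcases Finset.mem_insert.1 hM with rfl | hM
          · exact Finset.sdiff_disjoint
          · exact (hFR M hM).mono_left Finset.sdiff_subset
        · intro u hu v huv
          rw [hbU]
          rcases hbd u (Finset.mem_sdiff.1 hu).1 v huv with hv | hv
          · by_cases hvP : v ∈ P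
            · exact Or.inr (Finset.mem_union_right _ (Finset.mem_union_left _ hvP))
            · exact Or.inl (Finset.mem_sdiff.2 ⟨hv, hvP⟩)
          · exact Or.inr (Finset.union_subset_union le_rfl Finset.subset_union_right hv)
        · refine hKbig.trans_le (Nat.mul_le_mul_left 2 (Finset.card_le_card
            (Finset.inter_subset_inter_right fun v hv => Finset.mem_sdiff.2 ⟨hKR hv, ?_⟩)))
          exact Finset.disjoint_left.1 hKP hv
        · have h1 : (∑ v ∈ R \ P, ρ v) / t ≤ (∑ v ∈ R, ρ v) / t :=
            div_le_div_of_nonneg_right (hsum Finset.sdiff_subset) ht0.le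
          have h2 : R \ P ∪ (insert P F).biUnion id = R ∪ F.biUnion id := by
            rw [hbU, ← Finset.union_assoc, Finset.sdiff_union_of_subset hPR]
          rw [h2]
          linarith
    · push Not at hreach
      obtain ⟨M, hM, hMfar⟩ := hreach
      set Y : Finset V := R.filter fun y => ∃ x ∈ M, G.Adj x y with hY
      have hYR : Y ⊆ R := Finset.filter_subset _ _
      have hnoY : ∀ u ∈ R \ Y, ∀ x ∈ M, ¬ G.Adj x u := by
        intro u hu x hx hxu
        rw [Finset.mem_sdiff] at hu
        exact hu.2 (Finset.mem_filter.2 ⟨hu.1, x, hx, hxu⟩)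
      rcases Y.eq_empty_or_nonempty with hY0 | hYne
      · -- The bag `M` has no neighbour in `R` and is dropped.
        rw [hY0, Finset.sdiff_empty] at hnoY
        have hF' : F.erase M ⊆ F := Finset.erase_subset _ _
        refine ih R B (F.erase M) ?_ (hF.mono hF') (fun M hM => hFcard M (hF' hM))
          (fun M hM => hFR M (hF' hM)) ?_ hR ?_
        · have := Finset.card_erase_lt_of_mem hM
          omega
        · intro u hu v huv
          rcases hbd u hu v huv with hv | hv
          · exact Or.inl hv
          · right
            rcases Finset.mem_union.1 hv with hv | hv
            · exact Finset.mem_union_left _ hv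
            · exact Finset.mem_union_right _ (herase M hM u hu (hnoY u hu) v hv huv)
        · have h1 : (S ∩ (R ∪ (F.erase M).biUnion id)).card ≤ (S ∩ (R ∪ F.biUnion id)).card :=
            Finset.card_le_card (Finset.inter_subset_inter_left (Finset.union_subset_union le_rfl
              (Finset.biUnion_subset_biUnion_of_subset_left _ hF')))
          have h2 : ((S ∩ (R ∪ (F.erase M).biUnion id)).card : ℝ) * c
              ≤ (S ∩ (R ∪ F.biUnion id)).card * c :=
            mul_le_mul_of_nonneg_right (by exact_mod_cast h1) hc0
          linarith
      · -- The balls around `s` and `Y` are disjoint, so that one of them is small.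
        have hdisj : Disjoint (G.regionBall R {s} (t * Nat.size S.card))
            (G.regionBall R Y (t * Nat.size S.card)) := by
          rw [Finset.disjoint_left]
          intro v hv hv'
          obtain ⟨y, hy, hy'⟩ := exists_mem_regionBall_add hsR' hYR hv hv'
          obtain ⟨-, x, hx, hxy⟩ := Finset.mem_filter.1 hy
          exact hMfar y (hd ▸ hy') x hx hxy
        by_cases hsmall : 2 * (G.regionBall R {s} (t * Nat.size S.card) ∩ S).card ≤ S.card
        · refine hcut {s} F hsR' (Finset.singleton_nonempty s) subset_rfl hsmall
            (fun _ _ _ hv _ => hv) ⟨s, hsS, Finset.mem_union_left _ hsR, ?_⟩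
          rw [Finset.mem_union, not_or]
          refine ⟨by simp, fun hc => ?_⟩
          obtain ⟨M', hM', hsM'⟩ := Finset.mem_biUnion.1 hc
          exact Finset.disjoint_left.1 (hFR M' hM') hsR hsM'
        · have hsmall' : 2 * (G.regionBall R Y (t * Nat.size S.card) ∩ S).card ≤ S.card := by
            by_contra hbig
            exact not_disjoint_of_large (not_le.1 hsmall) (not_le.1 hbig) hdisj
          obtain ⟨z, hzM, hzS, -⟩ := hF.isBag M hM
          refine hcut Y (F.erase M) hYR hYne (Finset.erase_subset _ _) hsmall'
            (fun u hu => herase M hM u (Finset.mem_sdiff.1 hu).1 (hnoY u hu))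
            ⟨z, hzS, Finset.mem_union_right _ (Finset.mem_biUnion.2 ⟨M, hM, hzM⟩), ?_⟩
          rw [Finset.mem_union, not_or]
          refine ⟨fun hc => Finset.disjoint_left.1 (hFR M hM) (Finset.mem_sdiff.1 hc).1 hzM,
            fun hc => ?_⟩
          obtain ⟨M', hM', hzM'⟩ := Finset.mem_biUnion.1 hc
          rw [Finset.mem_erase] at hM'
          exact Finset.disjoint_left.1 (hF.disjoint M' hM'.2 M hM hM'.1) hzM' hzM

/-- The main loop, started from the whole graph and no bags. -/
theorem exists_halves {V : Type*} [Fintype V] [DecidableEq V] {G : SimpleGraph V}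
    {p : ℕ → ℕ} (hG : G.ExpansionBoundedBy p) {ρ : V → ℝ} (hρ : ∀ v, 0 ≤ ρ v) {t : ℕ}
    (ht : 1 ≤ t) (S : Finset V) {d h : ℕ}
    (hd : d = t * Nat.size S.card + t * Nat.size S.card) (hh : h = 2 * p d + 1) :
    ∃ B O : Finset V, G.Halves (B ∪ O) S ∧ ∑ v ∈ B, ρ v ≤ 2 * ((∑ v, ρ v) / t) ∧
      O.card ≤ h * (h * (d + 1) + 1) := by
  have hW0 : 0 ≤ ∑ v, ρ v := Finset.sum_nonneg fun v _ => hρ v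
  by_cases hdone : G.Halves ∅ S
  · exact ⟨∅, ∅, by simpa using hdone, by simp only [Finset.sum_empty]; positivity, by simp⟩
  have hS : S.Nonempty := by
    rw [Finset.nonempty_iff_ne_empty]
    rintro rfl
    exact hdone fun K _ _ => by simp
  have hm : (0 : ℝ) < S.card := by exact_mod_cast hS.card_pos
  have ht0 : (0 : ℝ) < t := by exact_mod_cast ht
  refine exists_halves_of_state hG hρ ht hS hd hh _ Finset.univ ∅ ∅ le_rfl
    ⟨by simp, by simp, by simp⟩ (by simp) (by simp) (by simp) ?_ ?_
  · have := hS.card_pos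
    rw [Finset.univ_inter]
    omega
  · rw [Finset.sum_empty, Finset.biUnion_empty, Finset.union_empty, Finset.inter_univ]
    apply le_of_eq
    field_simp
    ring

end SimpleGraph

/-! ### Polynomial bounds -/

theorem IsPolynomialFun.exists_le_pow {p : ℕ → ℕ} (hp : IsPolynomialFun p) :
    ∃ e : ℕ, ∀ n, p n ≤ (e * (n + 1)) ^ e := by
  obtain ⟨P, hP⟩ := hp
  set A : ℕ := ⌈∑ i ∈ Finset.range (P.natDegree + 1), |P.coeff i|⌉₊ with hA
  refine ⟨A + P.natDegree + 1, fun n => ?_⟩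
  have h1 : (p n : ℝ) ≤ A * ((n : ℝ) + 1) ^ P.natDegree := by
    have hAle := Nat.le_ceil (∑ i ∈ Finset.range (P.natDegree + 1), |P.coeff i|)
    rw [← hA] at hAle
    rw [hP, Polynomial.eval_eq_sum_range]
    refine le_trans ?_ (mul_le_mul_of_nonneg_right hAle (by positivity))
    rw [Finset.sum_mul]
    refine Finset.sum_le_sum fun i hi => ?_
    have hi' : i ≤ P.natDegree := Nat.lt_succ_iff.1 (Finset.mem_range.1 hi)
    have hn : (0 : ℝ) ≤ n := Nat.cast_nonneg n
    calc P.coeff i * (n : ℝ) ^ i ≤ |P.coeff i| * (n : ℝ) ^ i :=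
          mul_le_mul_of_nonneg_right (le_abs_self _) (by positivity)
      _ ≤ |P.coeff i| * ((n : ℝ) + 1) ^ P.natDegree := by
          refine mul_le_mul_of_nonneg_left ?_ (abs_nonneg _)
          exact (pow_le_pow_left₀ hn (by linarith) i).trans
            (pow_le_pow_right₀ (by linarith) hi')
  have h2 : p n ≤ A * (n + 1) ^ P.natDegree := by exact_mod_cast h1
  have hpos : 1 ≤ (A + P.natDegree + 1) * (n + 1) := Nat.mul_pos (by omega) (by omega)
  calc p n ≤ A * (n + 1) ^ P.natDegree := h2
    _ ≤ ((A + P.natDegree + 1) * (n + 1)) * ((A + P.natDegree + 1) * (n + 1)) ^ P.natDegree := by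
        refine Nat.mul_le_mul ?_ (Nat.pow_le_pow_left ?_ _) <;> nlinarith
    _ = ((A + P.natDegree + 1) * (n + 1)) ^ (P.natDegree + 1) := by rw [pow_succ']
    _ ≤ _ := Nat.pow_le_pow_right hpos (by omega)

namespace SimpleGraph

theorem exists_halves_pow {p : ℕ → ℕ} (hp : IsPolynomialFun p) :
    ∃ c : ℕ, ∀ (V : Type*) [Fintype V] [DecidableEq V] (G : SimpleGraph V),
      G.ExpansionBoundedBy p → ∀ ρ : V → ℝ, (∀ v, 0 ≤ ρ v) → ∀ t : ℕ, 1 ≤ t → ∀ S : Finset V,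
        ∃ B O : Finset V, G.Halves (B ∪ O) S ∧ ∑ v ∈ B, ρ v ≤ (∑ v, ρ v) / t ∧
          O.card ≤ (c * (t * Nat.size S.card)) ^ c := by
  obtain ⟨e, he⟩ := hp.exists_le_pow
  refine ⟨5 * e + 5, fun V _ _ G hG ρ hρ t ht S => ?_⟩
  rcases S.eq_empty_or_nonempty with rfl | hS
  · refine ⟨∅, ∅, fun K _ _ => by simp, ?_, by simp⟩
    have : 0 ≤ ∑ v, ρ v := Finset.sum_nonneg fun v _ => hρ v
    rw [Finset.sum_empty]
    positivity
  obtain ⟨B, O, hBO, hB, hO⟩ := exists_halves hG hρ (t := 2 * t) (by omega) S rfl rfl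
  refine ⟨B, O, hBO, hB.trans_eq ?_, hO.trans ?_⟩
  · have ht0 : (0 : ℝ) < t := by exact_mod_cast ht
    push_cast
    field_simp
  · set z := t * Nat.size S.card with hz
    have hz1 : 1 ≤ z := Nat.mul_pos ht (Nat.size_pos.2 hS.card_pos)
    have hd : 2 * t * Nat.size S.card + 2 * t * Nat.size S.card = 4 * z := by rw [hz]; ring
    rw [hd]
    set Y := (5 * e + 5) * z with hY
    have hY5 : 5 ≤ Y := by rw [hY]; nlinarith
    have hYz : 5 * z ≤ Y := Nat.mul_le_mul_right z (by omega)
    have hp' : p (4 * z) ≤ Y ^ e := (he _).trans (Nat.pow_le_pow_left (by rw [hY]; nlinarith) e)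
    have hYe : 1 ≤ Y ^ e := Nat.one_le_pow _ _ (by omega)
    have hh : 2 * p (4 * z) + 1 ≤ Y ^ (e + 1) := by rw [pow_succ]; nlinarith
    have hin : (2 * p (4 * z) + 1) * (4 * z + 1) + 1 ≤ Y ^ (e + 3) := by
      calc (2 * p (4 * z) + 1) * (4 * z + 1) + 1 ≤ Y ^ (e + 1) * Y + 1 := by
            gcongr
            omega
        _ = Y ^ (e + 2) + 1 := by rw [← pow_succ]
        _ ≤ Y ^ (e + 2) * Y := by
            have : 1 ≤ Y ^ (e + 2) := Nat.one_le_pow _ _ (by omega)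
            nlinarith
        _ = Y ^ (e + 3) := by rw [← pow_succ]
    calc _ ≤ Y ^ (e + 1) * Y ^ (e + 3) := Nat.mul_le_mul hh hin
      _ = Y ^ (2 * e + 4) := by rw [← pow_add]; congr 1; ring
      _ ≤ Y ^ (5 * e + 5) := Nat.pow_le_pow_right (by omega) (by omega)

/-! ### Separating the outliers of a separator -/

/-- Halving the part of `T` in the union `K` of the large linked sets, `j` times in a row, leaves at
most `|T| / 2 ^ j` vertices of `T` in `K`. Large linked sets meet each other, so `K` is linked. -/
theorem exists_halving_sequence {V : Type*} [Fintype V] [DecidableEq V] {G : SimpleGraph V}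
    {ρ : V → ℝ} (hρ : ∀ v, 0 ≤ ρ v) {S T : Finset V} {β : ℝ} {N : ℕ}
    (H : ∀ Q ⊆ T, ∃ B O : Finset V, G.Halves (B ∪ O) Q ∧ ∑ v ∈ B, ρ v ≤ β ∧ O.card ≤ N) (j : ℕ) :
    ∃ B O Q : Finset V, Q ⊆ T ∧ 2 ^ j * Q.card ≤ T.card ∧ ∑ v ∈ B, ρ v ≤ j * β ∧
      O.card ≤ j * N ∧
      ∀ K, G.IsLinked K → Disjoint K (B ∪ O) → S.card < 2 * (K ∩ S).card → K ∩ T ⊆ Q := by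
  classical
  induction j with
  | zero => exact ⟨∅, ∅, T, subset_rfl, by simp, by simp, by simp,
      fun _ _ _ _ => Finset.inter_subset_right⟩
  | succ j ih =>
    obtain ⟨B, O, Q, hQT, hQ, hB, hO, hBO⟩ := ih
    obtain ⟨B', O', hQ', hB', hO'⟩ := H Q hQT
    set F : Finset (Finset V) := Finset.univ.filter fun K => G.IsLinked K ∧
      Disjoint K ((B ∪ B') ∪ (O ∪ O')) ∧ S.card < 2 * (K ∩ S).card with hF
    have hFmem : ∀ K, K ∈ F ↔ G.IsLinked K ∧ Disjoint K ((B ∪ B') ∪ (O ∪ O')) ∧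
        S.card < 2 * (K ∩ S).card := fun K => by simp [hF]
    have hlink : G.IsLinked (F.biUnion id) :=
      isLinked_biUnion (fun K hK => ((hFmem K).1 hK).1) fun K hK K' hK' =>
        not_disjoint_of_large ((hFmem K).1 hK).2.2 ((hFmem K').1 hK').2.2
    have hdisj : Disjoint (F.biUnion id) (B' ∪ O') := by
      rw [Finset.disjoint_biUnion_left]
      exact fun K hK => ((hFmem K).1 hK).2.1.mono_right
        (Finset.union_subset_union Finset.subset_union_right Finset.subset_union_right)
    refine ⟨B ∪ B', O ∪ O', F.biUnion id ∩ Q, Finset.inter_subset_right.trans hQT, ?_, ?_, ?_, ?_⟩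
    · calc 2 ^ (j + 1) * (F.biUnion id ∩ Q).card = 2 ^ j * (2 * (F.biUnion id ∩ Q).card) := by ring
        _ ≤ 2 ^ j * Q.card := Nat.mul_le_mul_left _ (hQ' _ hlink hdisj)
        _ ≤ T.card := hQ
    · have h1 : ∑ v ∈ B ∪ B', ρ v ≤ ∑ v ∈ B, ρ v + ∑ v ∈ B', ρ v := by
        rw [← Finset.sum_union_inter]
        exact le_add_of_nonneg_right (Finset.sum_nonneg fun v _ => hρ v)
      push_cast
      linarith
    · refine (Finset.card_union_le _ _).trans ?_
      rw [Nat.succ_mul]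
      omega
    · intro K hK hKd hKbig
      refine Finset.subset_inter ?_ (hBO K hK (hKd.mono_right
        (Finset.union_subset_union Finset.subset_union_left Finset.subset_union_left)) hKbig)
      exact Finset.inter_subset_left.trans
        (Finset.subset_biUnion_of_mem id ((hFmem K).2 ⟨hK, hKd, hKbig⟩))

/-- If `B ∪ T` halves `S`, then the outliers `T` can be replaced by the outliers of logarithmically
many separators of subsets of `T`: afterwards no large linked set meets `T`. -/
theorem exists_halves_of_outliers {V : Type*} [Fintype V] [DecidableEq V] {G : SimpleGraph V}
    {ρ : V → ℝ} (hρ : ∀ v, 0 ≤ ρ v) {S T B : Finset V} {β : ℝ} {N : ℕ} (hBT : G.Halves (B ∪ T) S)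
    (H : ∀ Q ⊆ T, ∃ B O : Finset V, G.Halves (B ∪ O) Q ∧ ∑ v ∈ B, ρ v ≤ β ∧ O.card ≤ N) :
    ∃ B' O : Finset V, G.Halves (B' ∪ O) S ∧
      ∑ v ∈ B', ρ v ≤ ∑ v ∈ B, ρ v + Nat.size T.card * β ∧ O.card ≤ Nat.size T.card * N := by
  obtain ⟨B', O, Q, -, hQ, hB', hO, hK⟩ := exists_halving_sequence (S := S) hρ H (Nat.size T.card)
  have hQ0 : Q = ∅ := by
    have h1 := Nat.lt_size_self T.card
    rw [← Finset.card_eq_zero]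
    by_contra h0
    have := Nat.mul_le_mul_left (2 ^ Nat.size T.card) (Nat.one_le_iff_ne_zero.2 h0)
    omega
  refine ⟨B ∪ B', O, fun K hKl hKd => ?_, ?_, hO⟩
  · by_contra! hKbig
    have h1 := hK K hKl (hKd.mono_right
      (Finset.union_subset_union Finset.subset_union_right le_rfl)) hKbig
    rw [hQ0, Finset.subset_empty, ← Finset.disjoint_iff_inter_eq_empty] at h1
    have h2 := hBT K hKl (Finset.disjoint_union_right.2 ⟨hKd.mono_right
      (Finset.subset_union_left.trans Finset.subset_union_left), h1⟩)
    omega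
  · have h1 : ∑ v ∈ B ∪ B', ρ v ≤ ∑ v ∈ B, ρ v + ∑ v ∈ B', ρ v := by
      rw [← Finset.sum_union_inter]
      exact le_add_of_nonneg_right (Finset.sum_nonneg fun v _ => hρ v)
    linarith

end SimpleGraph

/-! ### Iterated logarithms -/

theorem one_le_iterLog_succ (a : ℕ) (x : ℝ) : 1 ≤ iterLog (a + 1) x := by
  rw [iterLog, Real.le_logb_iff_rpow_le (by norm_num) (by positivity)]
  simp

theorem le_two_rpow_iterLog_succ (a : ℕ) (x : ℝ) :
    iterLog a x ≤ (2 : ℝ) ^ iterLog (a + 1) x := by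
  rw [iterLog, Real.rpow_logb (by norm_num) (by norm_num) (by positivity)]
  exact le_max_right _ _

theorem natSize_le_of_le_two_rpow {m : ℕ} {r : ℝ} (hr : 0 ≤ r) (h : (m : ℝ) ≤ (2 : ℝ) ^ r) :
    (Nat.size m : ℝ) ≤ r + 1 := by
  rcases Nat.eq_zero_or_pos m with rfl | hm
  · simp only [Nat.size_zero, Nat.cast_zero]
    linarith
  have hs : 0 < Nat.size m := Nat.size_pos.2 hm
  have h1 : 2 ^ (Nat.size m - 1) ≤ m := Nat.lt_size.1 (by omega)
  have h2 : (2 : ℝ) ^ ((Nat.size m - 1 : ℕ) : ℝ) ≤ (2 : ℝ) ^ r := by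
    rw [Real.rpow_natCast]
    exact le_trans (by exact_mod_cast h1) h
  have h3 := (Real.rpow_le_rpow_left_iff (by norm_num)).1 h2
  rw [Nat.cast_sub hs, Nat.cast_one] at h3
  linarith

/-- A power of the next iterated logarithm is dominated by the current one. -/
theorem exists_iterLog_succ_pow_le (a c : ℕ) : ∃ K : ℝ, 0 ≤ K ∧ ∀ x, 1 ≤ iterLog a x →
    iterLog (a + 1) x ^ c ≤ K * iterLog a x := by
  have hlog : 0 < Real.log 2 := Real.log_pos (by norm_num)
  refine ⟨c.factorial / Real.log 2 ^ c * 2, by positivity, fun x hx => ?_⟩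
  set y := iterLog (a + 1) x with hy
  have hy1 : 1 ≤ y := one_le_iterLog_succ a x
  have h1 := Real.pow_div_factorial_le_exp (y * Real.log 2) (by positivity) c
  have h2 : Real.exp (y * Real.log 2) = max 2 (iterLog a x) := by
    rw [mul_comm, ← Real.rpow_def_of_pos (by norm_num), hy, iterLog,
      Real.rpow_logb (by norm_num) (by norm_num) (by positivity)]
  have h3 : max 2 (iterLog a x) ≤ 2 * iterLog a x := max_le (by linarith) (by linarith)
  rw [h2, mul_pow, div_le_iff₀ (by positivity)] at h1
  rw [div_mul_eq_mul_div, div_mul_eq_mul_div, le_div_iff₀ (by positivity)]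
  have h4 : (0 : ℝ) < c.factorial := by exact_mod_cast c.factorial_pos
  nlinarith

namespace SimpleGraph

theorem exists_halves_iterLog {p : ℕ → ℕ} (hp : IsPolynomialFun p) (a : ℕ) :
    ∃ c : ℕ, ∀ (V : Type*) [Fintype V] [DecidableEq V] (G : SimpleGraph V),
      G.ExpansionBoundedBy p → ∀ ρ : V → ℝ, (∀ v, 0 ≤ ρ v) → ∀ t : ℕ, 1 ≤ t → ∀ S : Finset V,
        ∃ B O : Finset V, G.Halves (B ∪ O) S ∧ ∑ v ∈ B, ρ v ≤ (∑ v, ρ v) / t ∧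
          (O.card : ℝ) ≤ (c * (t * iterLog (a + 1) S.card)) ^ c := by
  obtain ⟨c₁, hc₁⟩ := exists_halves_pow hp
  induction a with
  | zero =>
    refine ⟨2 * c₁, fun V _ _ G hG ρ hρ t ht S => ?_⟩
    obtain ⟨B, O, hBO, hB, hO⟩ := hc₁ V G hG ρ hρ t ht S
    refine ⟨B, O, hBO, hB, ?_⟩
    set x := iterLog (0 + 1) S.card with hx
    have hx1 : 1 ≤ x := one_le_iterLog_succ 0 _
    have hsize : (Nat.size S.card : ℝ) ≤ 2 * x := by
      have := natSize_le_of_le_two_rpow (by linarith) (le_two_rpow_iterLog_succ 0 (S.card : ℝ))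
      linarith
    have ht1 : (1 : ℝ) ≤ t := by exact_mod_cast ht
    rcases Nat.eq_zero_or_pos c₁ with rfl | hc
    · simpa using hO
    have hc' : (1 : ℝ) ≤ c₁ := by exact_mod_cast hc
    have htx : 1 ≤ (t : ℝ) * x := one_le_mul_of_one_le_of_one_le ht1 hx1
    calc (O.card : ℝ) ≤ (c₁ * (t * Nat.size S.card)) ^ c₁ := by exact_mod_cast hO
      _ ≤ (c₁ * (t * (2 * x))) ^ c₁ := by gcongr
      _ = ((2 * c₁ : ℕ) * (t * x)) ^ c₁ := by push_cast; ring
      _ ≤ ((2 * c₁ : ℕ) * (t * x)) ^ (2 * c₁) := by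
          refine pow_le_pow_right₀ (one_le_mul_of_one_le_of_one_le ?_ htx) (by omega)
          exact_mod_cast (by omega : 1 ≤ 2 * c₁)
  | succ a ih =>
    obtain ⟨c, hc⟩ := ih
    set k : ℕ := 2 * c ^ 2 + c + 2 with hk
    refine ⟨2 * c₁ * k ^ 2 + k + (3 * c₁ + 1), fun V _ _ G hG ρ hρ t ht S => ?_⟩
    have hW0 : 0 ≤ ∑ v, ρ v := Finset.sum_nonneg fun v _ => hρ v
    obtain ⟨B, T, hBT, hB, hT⟩ := hc V G hG ρ hρ (2 * t) (by omega) S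
    set L := Nat.size T.card with hL
    set x := iterLog (a + 1) S.card with hx
    set y := iterLog (a + 1 + 1) S.card with hy
    have hx1 : 1 ≤ x := one_le_iterLog_succ a _
    have hy1 : 1 ≤ y := one_le_iterLog_succ (a + 1) _
    have hxy : x ≤ (2 : ℝ) ^ y := le_two_rpow_iterLog_succ (a + 1) _
    have ht1 : (1 : ℝ) ≤ t := by exact_mod_cast ht
    -- The number `L` of rounds is logarithmic in the number of outliers, since `|T|` is at most
    -- `2 ^ (c * (2 * c * t + y))`.
    have hLle : (L : ℝ) + 1 ≤ k * (t * y) := by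
      have h1 : (c * ((2 * t : ℕ) * x)) ^ c ≤ (2 : ℝ) ^ ((2 * c * t + y) * c) := by
        rw [Real.rpow_mul (by norm_num), Real.rpow_natCast]
        refine pow_le_pow_left₀ (by positivity) ?_ c
        rw [Real.rpow_add (by norm_num), ← mul_assoc]
        refine mul_le_mul ?_ hxy (by positivity) (by positivity)
        have h2 : c * (2 * t) ≤ 2 ^ (2 * c * t) := by
          have := (Nat.lt_two_pow_self (n := 2 * c * t)).le
          calc c * (2 * t) = 2 * c * t := by ring
            _ ≤ _ := this
        have h3 : ((2 : ℝ) ^ (2 * (c : ℝ) * t)) = ((2 ^ (2 * c * t) : ℕ) : ℝ) := by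
          rw [Nat.cast_pow, ← Real.rpow_natCast]
          push_cast
          rfl
        rw [h3]
        exact_mod_cast h2
      have h4 := natSize_le_of_le_two_rpow (by positivity) (hT.trans h1)
      rw [← hL] at h4
      have hc0 : (0 : ℝ) ≤ c := Nat.cast_nonneg c
      have h5 : (t : ℝ) ≤ t * y := le_mul_of_one_le_right (by positivity) hy1
      have h6 : y ≤ t * y := le_mul_of_one_le_left (by positivity) ht1
      have h7 : (1 : ℝ) ≤ t * y := hy1.trans h6
      have h8 : 2 * (c : ℝ) ^ 2 * t ≤ 2 * (c : ℝ) ^ 2 * (t * y) := by gcongr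
      have h9 : (c : ℝ) * y ≤ c * (t * y) := by gcongr
      rw [hk]
      push_cast
      nlinarith
    have hH : ∀ Q ⊆ T, ∃ B O : Finset V, G.Halves (B ∪ O) Q ∧
        ∑ v ∈ B, ρ v ≤ (∑ v, ρ v) / (2 * t * (L + 1) : ℕ) ∧
        O.card ≤ (c₁ * (2 * t * (L + 1) * L)) ^ c₁ := by
      intro Q hQ
      obtain ⟨B, O, h1, h2, h3⟩ :=
        hc₁ V G hG ρ hρ (2 * t * (L + 1)) (Nat.mul_pos (by omega) (by omega)) Q
      refine ⟨B, O, h1, h2, h3.trans ?_⟩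
      have := Nat.size_le_size (Finset.card_le_card hQ)
      gcongr
    obtain ⟨B', O, hBO, hB', hO⟩ := exists_halves_of_outliers hρ hBT hH
    refine ⟨B', O, hBO, hB'.trans ?_, ?_⟩
    · rw [← hL]
      have h1 : (L : ℝ) * ((∑ v, ρ v) / (2 * t * (L + 1) : ℕ)) ≤ (∑ v, ρ v) / (2 * t) := by
        have hLL : (L : ℝ) / (L + 1) ≤ 1 := (div_le_one (by positivity)).2 (by linarith)
        have h2 : (L : ℝ) * ((∑ v, ρ v) / (2 * t * (L + 1) : ℕ))
            = (∑ v, ρ v) / (2 * t) * (L / (L + 1)) := by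
          push_cast
          field_simp
        rw [h2]
        exact mul_le_of_le_one_right (by positivity) hLL
      have h2 : (∑ v, ρ v) / (t : ℝ) = (∑ v, ρ v) / (2 * t) + (∑ v, ρ v) / (2 * t) := by
        field_simp
        ring
      push_cast at hB
      linarith
    · set z := (t : ℝ) * y with hz
      have hz1 : 1 ≤ z := one_le_mul_of_one_le_of_one_le ht1 hy1
      have htz : (t : ℝ) ≤ z := le_mul_of_one_le_right (by positivity) hy1
      set c₂ : ℕ := 2 * c₁ * k ^ 2 + k + (3 * c₁ + 1) with hc₂
      have hc₂1 : (1 : ℝ) ≤ c₂ := by exact_mod_cast (by omega : 1 ≤ c₂)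
      have hk₂ : (k : ℝ) ≤ c₂ := by
        exact_mod_cast (by rw [hc₂]; have := Nat.zero_le (2 * c₁ * k ^ 2); omega : k ≤ c₂)
      have hck₂ : 2 * (c₁ : ℝ) * k ^ 2 ≤ c₂ := by
        exact_mod_cast (by omega : 2 * c₁ * k ^ 2 ≤ c₂)
      have hL' : (L : ℝ) ≤ k * z := by linarith
      have hcz1 : 1 ≤ c₂ * z := one_le_mul_of_one_le_of_one_le hc₂1 hz1
      calc (O.card : ℝ) ≤ L * (c₁ * (2 * t * (L + 1) * L)) ^ c₁ := by exact_mod_cast hO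
        _ ≤ (k * z) * (c₁ * (2 * z * (k * z) * (k * z))) ^ c₁ := by gcongr
        _ = (k * z) * ((2 * c₁ * k ^ 2) * z ^ 3) ^ c₁ := by ring
        _ ≤ (c₂ * z) * (c₂ ^ 3 * z ^ 3) ^ c₁ := by
            gcongr
            exact hck₂.trans (le_self_pow₀ hc₂1 (by norm_num))
        _ = (c₂ * z) ^ (3 * c₁ + 1) := by rw [← mul_pow, ← pow_mul, pow_succ']
        _ ≤ (c₂ * z) ^ c₂ := pow_le_pow_right₀ hcz1 (by omega)

end SimpleGraph

theorem mainTheorem2 (p : ℕ → ℕ) (hp : IsPolynomialFun p) (a : ℕ) :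
    ∃ q : ℕ → ℕ, IsPolynomialFun q ∧
      ∀ (V : Type*) [Fintype V] [DecidableEq V] (G : SimpleGraph V),
        G.ExpansionBoundedBy p →
          ∀ (ρ : V → ℝ≥0) (t : ℕ), 1 ≤ t →
            ∃ C : Finset V, G.IsBalancedSeparator C ∧
              CheapWithOutliers ρ t
                (Real.exp (q t : ℝ) * iterLog a (Fintype.card V : ℝ)) C := by
  obtain ⟨c, hc⟩ := SimpleGraph.exists_halves_iterLog hp a
  obtain ⟨K, hK0, hK⟩ := exists_iterLog_succ_pow_le a c
  set k : ℕ := ⌈(c : ℝ) ^ c * K⌉₊ with hk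
  refine ⟨fun t => (k + c) * t, ⟨Polynomial.C ((k + c : ℕ) : ℝ) * Polynomial.X, by simp⟩,
    fun V _ _ G hG ρ t ht => ?_⟩
  obtain ⟨B, O, hBO, hB, hO⟩ := hc V G hG (fun v => (ρ v : ℝ)) (fun v => (ρ v).2) t ht Finset.univ
  refine ⟨B ∪ O, hBO.isBalancedSeparator, O, Finset.subset_union_right, ?_, ?_⟩
  · rw [Finset.card_univ] at hO
    rcases Nat.eq_zero_or_pos (Fintype.card V) with h0 | hpos
    · have hO0 : O.card = 0 := Nat.le_zero.1 (h0 ▸ Finset.card_le_univ O)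
      rw [hO0, h0, Nat.cast_zero]
      refine mul_nonneg (Real.exp_pos _).le ?_
      cases a with
      | zero => simp [iterLog]
      | succ a => exact zero_le_one.trans (one_le_iterLog_succ a _)
    have hn : 1 ≤ iterLog a (Fintype.card V : ℝ) := by
      cases a with
      | zero => exact (by exact_mod_cast hpos : (1 : ℝ) ≤ (Fintype.card V : ℝ))
      | succ a => exact one_le_iterLog_succ a _
    have ht1 : (1 : ℝ) ≤ t := by exact_mod_cast ht
    have hkt : (c : ℝ) ^ c * K ≤ Real.exp (k * t) := by
      have h1 : (c : ℝ) ^ c * K ≤ k := Nat.le_ceil _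
      have h2 : (k : ℝ) ≤ k * t := le_mul_of_one_le_right (Nat.cast_nonneg k) ht1
      have h3 := Real.add_one_le_exp ((k : ℝ) * t)
      linarith
    have hct : (t : ℝ) ^ c ≤ Real.exp (c * t) := by
      rw [Real.exp_nat_mul]
      refine pow_le_pow_left₀ (by positivity) ?_ c
      have := Real.add_one_le_exp (t : ℝ)
      linarith
    calc (O.card : ℝ) ≤ (c * (t * iterLog (a + 1) (Fintype.card V : ℝ))) ^ c := hO
      _ = (c : ℝ) ^ c * (t : ℝ) ^ c * iterLog (a + 1) (Fintype.card V : ℝ) ^ c := by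
          rw [mul_pow, mul_pow, mul_assoc]
      _ ≤ (c : ℝ) ^ c * (t : ℝ) ^ c * (K * iterLog a (Fintype.card V : ℝ)) := by
          gcongr
          exact hK _ hn
      _ = ((c : ℝ) ^ c * K) * (t : ℝ) ^ c * iterLog a (Fintype.card V : ℝ) := by ring
      _ ≤ Real.exp (k * t) * Real.exp (c * t) * iterLog a (Fintype.card V : ℝ) := by gcongr
      _ = Real.exp (((k + c) * t : ℕ) : ℝ) * iterLog a (Fintype.card V : ℝ) := by
          rw [← Real.exp_add]
          push_cast
          ring_nf
  · have h1 : ∑ v ∈ (B ∪ O) \ O, ρ v ≤ ∑ v ∈ B, ρ v := by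
      refine Finset.sum_le_sum_of_subset ?_
      rw [Finset.union_sdiff_right]
      exact Finset.sdiff_subset
    refine h1.trans ?_
    rw [← NNReal.coe_le_coe]
    push_cast
    exact hB
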